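/- Let $\Sigma$ be a finite alphabet. For $k\ge 1$, a \emph{real-time nondeterministic blind vector automaton of dimension $k$} (rtNBVA($k$)) over $\Sigma$ consists of a finite set $Q$ of states, an initial state $q_0\in Q$, a set $Q_a\subseteq Q$ of accept states, an initial row vector $v\in\mathbb{Q}^k$, and a transition function $\delta$ that assigns to each state $q\in Q$ and each symbol $\sigma\in\Sigma\cup\{\rhd,\lhd\}$ (where $\rhd,\lhd\notin\Sigma$ are the left and right endmarkers) a finite set $\delta(q,\sigma)\subseteq Q\times\mathbb{Q}^{k\times k}$ of possible moves. On input $w\in\Sigma^*$ it scans the string $\rhd w\lhd$ from left to right, one symbol per step, starting in state $q_0$ with vector $v$; when it scans $\sigma$ in state $q$ it chooses some $(q',M)\in\delta(q,\sigma)$, enters state $q'$ and replaces its current row vector $x$ by $xM$ (if $\delta(q,\sigma)=\emptyset$, the computation is abandoned). The input $w$ is accepted if some computation scans all of $\rhd w\lhd$ and ends in an accept state with the first entry of the vector equal to $1$. The automaton is a \emph{real-time deterministic blind vector automaton} (rtDBVA($k$)) if $\delta(q,\sigma)$ always consists of exactly one move. Let $\mathfrak{L}(\mathrm{rtNBVA}(k))$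 and $\mathfrak{L}(\mathrm{rtDBVA}(k))$ denote the classes of languages over $\Sigma$ recognized by such automata. \textbf{Theorem.} Let $a\in\Sigma$. The unary language $\mathtt{POW}=\{a^{k+2^k} : k\in\mathbb{N},\ k>0\}$ is not regular; it is recognized by an rtNBVA(2), but it is not recognized by any rtDBVA($k$), for any $k\ge 1$. Consequently $$\mathfrak{L}(\mathrm{rtNBVA}(2))\not\subseteq\bigcup_{k\ge 1}\mathfrak{L}(\mathrm{rtDBVA}(k)).$$ (In particular this holds for the one-letter alphabet $\Sigma=\{a\}$.) -/

import Mathlib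

/-- The symbols on the tape of a machine with input alphabet `α`: the left endmarker, the letters
of the input alphabet, and the right endmarker. -/
inductive TapeSymbol (α : Type*) where
  | leftEnd : TapeSymbol α
  | letter (a : α) : TapeSymbol α
  | rightEnd : TapeSymbol α

/-- The tape contents for the input `w`: the word `w` between the two endmarkers. -/
def tape {α : Type*} (w : List α) : List (TapeSymbol α) :=
  TapeSymbol.leftEnd :: (w.map TapeSymbol.letter ++ [TapeSymbol.rightEnd])

/-- A real-time deterministic blind vector automaton of dimension `k` with input alphabet `α` and
set of states `Q` (finiteness of `Q` is required where the language class is defined). -/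
structure RTDBVA (k : ℕ) (α : Type*) (Q : Type*) where
  /-- The transition function: next state, and matrix multiplying the current vector. -/
  δ : Q → TapeSymbol α → Q × Matrix (Fin k) (Fin k) ℚ
  /-- The initial state. -/
  start : Q
  /-- The set of accept states. -/
  accept : Set Q
  /-- The initial row vector. -/
  v : Fin k → ℚ

namespace RTDBVA

variable {k : ℕ} {α Q : Type*} (M : RTDBVA k α Q)

/-- One step: the state is updated and the row vector is multiplied on the right by the matrix
given by the transition function. -/
def step (c : Q × (Fin k → ℚ)) (x : TapeSymbol α) : Q × (Fin k → ℚ) :=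
  ((M.δ c.1 x).1, Matrix.vecMul c.2 (M.δ c.1 x).2)

/-- The configuration (state and vector) after the whole tape has been scanned. -/
def final (w : List α) : Q × (Fin k → ℚ) :=
  (tape w).foldl M.step (M.start, M.v)

/-- The recognized language: a word is accepted when, after the right endmarker has been processed,
the machine is in an accept state and the first entry of the vector is `1`. -/
def language [NeZero k] : Language α :=
  {w | (M.final w).1 ∈ M.accept ∧ (M.final w).2 0 = 1}

end RTDBVA

/-- A real-time nondeterministic blind vector automaton of dimension `k` with input alphabet `α`
and set of states `Q`. In each situation there are finitely many possible moves. -/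
structure RTNBVA (k : ℕ) (α : Type*) (Q : Type*) where
  /-- The transition function: the finite set of possible moves, each consisting of a next state
  and a matrix multiplying the current vector. -/
  δ : Q → TapeSymbol α → Finset (Q × Matrix (Fin k) (Fin k) ℚ)
  /-- The initial state. -/
  start : Q
  /-- The set of accept states. -/
  accept : Set Q
  /-- The initial row vector. -/
  v : Fin k → ℚ

namespace RTNBVA

variable {k : ℕ} {α Q : Type*} (M : RTNBVA k α Q)

/-- `M.Reaches c u d`: some computation of `M` that starts in configuration `c` and scans the
tape segment `u`, one symbol per step, ends in configuration `d`. -/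
def Reaches : Q × (Fin k → ℚ) → List (TapeSymbol α) → Q × (Fin k → ℚ) → Prop
  | c, [], d => c = d
  | c, x :: u, d => ∃ m ∈ M.δ c.1 x, Reaches (m.1, Matrix.vecMul c.2 m.2) u d

/-- The recognized language: a word is accepted when some computation scans the whole tape and
ends in an accept state with first entry of the vector equal to `1`. -/
def language [NeZero k] : Language α :=
  {w | ∃ d : Q × (Fin k → ℚ), M.Reaches (M.start, M.v) (tape w) d ∧ d.1 ∈ M.accept ∧ d.2 0 = 1}

end RTNBVA

/-- The class of languages over `α` recognized by real-time deterministic blind vector automata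
of dimension `k`. -/
def classRTDBVA (k : ℕ) [NeZero k] (α : Type*) : Set (Language α) :=
  {L | ∃ (Q : Type) (_ : Finite Q) (M : RTDBVA k α Q), M.language = L}

/-- The class of languages over `α` recognized by real-time nondeterministic blind vector automata
of dimension `k`. -/
def classRTNBVA (k : ℕ) [NeZero k] (α : Type*) : Set (Language α) :=
  {L | ∃ (Q : Type) (_ : Finite Q) (M : RTNBVA k α Q), M.language = L}

/-- The unary language of the words `a ^ (k + 2 ^ k)` with `k > 0`. -/
def powLanguage {α : Type*} (a : α) : Language α :=
  {w | ∃ k : ℕ, 0 < k ∧ w = List.replicate (k + 2 ^ k) a}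

/-!
The nondeterministic machine keeps the vector `(x, 1)`: it doubles `x` on an initial block of `k`
letters, then, from a guessed moment on, decrements `x` on each letter, and finally checks that
exactly `2 ^ k` letters were left (`powMachine`).

For the deterministic machines, coding the state into the vector shows that `a ^ n` is accepted
iff `x ⬝ A ^ n ⬝ y = 1` for a fixed rational matrix `A` and vectors `x`, `y`
(`RTDBVA.exists_matrix_replicate_mem_language`). Two facts then clash.

* The numbers `k + 2 ^ k` meet every residue class modulo every `P > 0`
  (`exists_add_two_pow_modEq`).
* After clearing denominators, write the characteristic polynomial of the integer matrix as
  `X ^ s * g` with `g(0) ≠ 0`. Modulo any number coprime to `g(0)`, the powers of the matrix are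
  periodic from exponent `s` on, where `s` does not depend on the modulus
  (`Matrix.exists_forall_pow_add_eq_pow`). So if `x ⬝ A ^ n ⬝ y = 1` for all `n` in a set meeting
  all residue classes, then for every `m ≥ s` the equation holds modulo all powers of a suitable
  prime, and hence holds (`Matrix.exists_forall_ge_dotProduct_eq_one`).

Hence `a ^ m` would be accepted for all large `m`, although `k + 1 + 2 ^ k` is never of the form
`j + 2 ^ j` for `k > 0`. Non-regularity follows, since a finite automaton is a deterministic
blind vector automaton of dimension one whose matrices are all the identity.
-/

open scoped Matrix

/-! ### Residues of `k + 2 ^ k` -/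

/-- The proof is by strong induction on the modulus `P`: if `T` is the totient of the odd part of
`P`, then for large `k` replacing `k` by `k + T * t` adds `T * t` to `k + 2 ^ k` modulo `P`, so that
it suffices to solve the congruence modulo `gcd P T < P`. -/
theorem exists_add_two_pow_modEq (P : ℕ) (hP : 0 < P) (m K : ℕ) :
    ∃ k, K ≤ k ∧ k + 2 ^ k ≡ m [MOD P] := by
  induction P using Nat.strong_induction_on generalizing K with
  | _ P ih =>
    rcases Nat.lt_or_ge 1 P with h1 | h1
    swap
    · obtain rfl : P = 1 := by omega
      exact ⟨K, le_rfl, Nat.modEq_one⟩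
    obtain ⟨r, b, hb, rfl⟩ := Nat.exists_eq_two_pow_mul_odd hP.ne'
    have hb0 : 0 < b := hb.pos
    set T := b.totient with hT
    have hT0 : 0 < T := Nat.totient_pos.2 hb0
    have hTP : T < 2 ^ r * b := by
      rcases Nat.eq_zero_or_pos r with rfl | hr
      · rw [pow_zero, one_mul] at h1 ⊢
        exact Nat.totient_lt b h1
      · have h2 : 2 ≤ 2 ^ r := Nat.le_self_pow hr.ne' 2
        have := Nat.totient_le b
        nlinarith
    obtain ⟨k, hk, hmod⟩ := ih (Nat.gcd (2 ^ r * b) T)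
      (lt_of_le_of_lt (Nat.gcd_le_right _ hT0) hTP) (Nat.gcd_pos_of_pos_right _ hT0) (max K r)
    have hper : ∀ t, 2 ^ (k + T * t) ≡ 2 ^ k [MOD 2 ^ r * b] := by
      intro t
      obtain ⟨j, rfl⟩ : ∃ j, k = r + j := Nat.exists_eq_add_of_le (le_trans (le_max_right _ _) hk)
      have h2 : 2 ^ T ≡ 1 [MOD b] := Nat.ModEq.pow_totient (Nat.coprime_two_left.2 hb)
      have h3 : 2 ^ (j + T * t) ≡ 2 ^ j [MOD b] := by
        have := (h2.pow t).mul_left (2 ^ j)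
        rwa [one_pow, mul_one, ← pow_mul, ← pow_add] at this
      have := h3.mul_left' (2 ^ r)
      rwa [← pow_add, ← pow_add, ← add_assoc] at this
    -- Solve `T * t ≡ m - (k + 2 ^ k)` modulo `P` by Bézout.
    obtain ⟨z, hz⟩ := (Nat.modEq_iff_dvd.1 hmod)
    have hbez := Nat.gcd_eq_gcd_ab (2 ^ r * b) T
    set P := 2 ^ r * b with hPdef
    have hPz : (0 : ℤ) < P := by exact_mod_cast hP
    set t0 : ℤ := Nat.gcdB P T * z
    refine ⟨k + T * (t0 % P).toNat, by have := le_max_left K r; omega, ?_⟩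
    have h4 : (((t0 % P).toNat : ℕ) : ℤ) = t0 % P := Int.toNat_of_nonneg (Int.emod_nonneg _ hPz.ne')
    have h5 : k + T * (t0 % P).toNat + 2 ^ (k + T * (t0 % P).toNat) ≡
        k + T * (t0 % P).toNat + 2 ^ k [MOD P] := (hper _).add_left _
    refine h5.trans (Nat.modEq_iff_dvd.2 ?_)
    refine ⟨Nat.gcdA P T * z + T * (t0 / P), ?_⟩
    push_cast at hz ⊢
    rw [h4, Int.emod_def]
    rw [hbez] at hz
    simp only [t0]
    linear_combination hz

theorem add_two_pow_strictMono : StrictMono fun k : ℕ => k + 2 ^ k :=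
  strictMono_id.add (pow_right_strictMono₀ one_lt_two)

/-- Consecutive values of `k + 2 ^ k` are more than one apart. -/
theorem succ_add_two_pow_ne (k j : ℕ) (hk : 0 < k) : k + 2 ^ k + 1 ≠ j + 2 ^ j := by
  intro h
  have h1 : k < j := add_two_pow_strictMono.lt_iff_lt.1 (by omega)
  have h2 : (k + 1) + 2 ^ (k + 1) ≤ j + 2 ^ j := add_two_pow_strictMono.monotone h1
  have h3 : 2 ≤ 2 ^ k := Nat.le_self_pow hk.ne' 2
  rw [pow_succ] at h2
  omega

/-! ### Periodicity of the powers of an integer matrix modulo an integer -/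

/-- The powers of `b` become periodic as soon as `b` can be cancelled, which the hypothesis
allows from the exponent `s` on. -/
theorem exists_forall_pow_add_eq_pow {R : Type*} [Monoid R] [Finite R] {b t : R} {s : ℕ}
    (h : b ^ s = b ^ (s + 1) * t) :
    ∃ P, 0 < P ∧ ∀ n, s ≤ n → b ^ (n + P) = b ^ n := by
  obtain ⟨i, j, hij, heq⟩ := Finite.exists_ne_map_eq_of_infinite fun n : ℕ => b ^ n
  wlog hlt : i < j generalizing i j
  · exact this j i hij.symm heq.symm (by omega)
  obtain ⟨P, rfl⟩ := Nat.exists_eq_add_of_lt hlt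
  have hpow : ∀ l, b ^ s = b ^ (s + l) * t ^ l := by
    intro l
    induction l with
    | zero => simp
    | succ l ih =>
      calc b ^ s = b ^ (s + l) * t ^ l := ih
        _ = b ^ l * b ^ s * t ^ l := by rw [← pow_add, add_comm]
        _ = b ^ l * (b ^ (s + 1) * t) * t ^ l := by rw [← h]
        _ = b ^ (s + (l + 1)) * t ^ (l + 1) := by
          rw [pow_succ' t, ← mul_assoc, ← mul_assoc, ← pow_add]
          congr 3
          omega
  refine ⟨P + 1, by omega, fun n hn => ?_⟩
  have key : b ^ (s + (P + 1)) = b ^ s := by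
    calc b ^ (s + (P + 1)) = b ^ (P + 1) * (b ^ (s + i) * t ^ i) := by
          rw [← hpow i, ← pow_add, add_comm]
      _ = b ^ s * b ^ (i + P + 1) * t ^ i := by
          rw [← mul_assoc, ← pow_add, ← pow_add]
          congr 2
          omega
      _ = b ^ s := by rw [← heq, ← pow_add, ← hpow i]
  obtain ⟨l, rfl⟩ := Nat.exists_eq_add_of_le hn
  rw [show s + l + (P + 1) = l + (s + (P + 1)) by omega, pow_add, key, ← pow_add, add_comm]

/-- The exponent `s` is the multiplicity of the root `0` of the characteristic polynomial, and
`g₀` is its lowest nonzero coefficient. -/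
theorem Matrix.exists_forall_pow_add_eq_pow {ι : Type*} [Fintype ι] [DecidableEq ι]
    (B : Matrix ι ι ℤ) :
    ∃ (s : ℕ) (g₀ : ℤ), g₀ ≠ 0 ∧ ∀ N : ℕ, N ≠ 0 → IsUnit (g₀ : ZMod N) →
      ∃ P, 0 < P ∧ ∀ n, s ≤ n →
        (B.map (Int.cast : ℤ → ZMod N)) ^ (n + P) = (B.map (Int.cast : ℤ → ZMod N)) ^ n := by
  obtain ⟨g, hg, hgX⟩ := Polynomial.exists_eq_pow_rootMultiplicity_mul_and_not_dvd B.charpoly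
    B.charpoly_monic.ne_zero 0
  rw [Polynomial.C_0, sub_zero] at hg hgX
  set s := B.charpoly.rootMultiplicity 0
  refine ⟨s, g.coeff 0, fun h => hgX (Polynomial.X_dvd_iff.2 h), fun N hN hu => ?_⟩
  have : NeZero N := ⟨hN⟩
  set D : Matrix ι ι ℤ := Polynomial.aeval B g.divX with hD
  have hcomm : Commute B D := by
    have := (Commute.all Polynomial.X g.divX).map (Polynomial.aeval B)
    rwa [Polynomial.aeval_X] at this
  have hzero : B ^ s * (D * B + (g.coeff 0 : Matrix ι ι ℤ)) = 0 := by
    have h := B.aeval_self_charpoly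
    rw [hg, map_mul, map_pow, Polynomial.aeval_X, ← Polynomial.divX_mul_X_add g, map_add, map_mul,
      Polynomial.aeval_X, Polynomial.aeval_C] at h
    simpa using h
  set φ := (Int.castRingHom (ZMod N)).mapMatrix (m := ι)
  have hφ : B.map (Int.cast : ℤ → ZMod N) = φ B := rfl
  have hzero' : φ B ^ s * (φ D * φ B + (g.coeff 0 : Matrix ι ι (ZMod N))) = 0 := by
    have := congrArg φ hzero
    simpa using this
  obtain ⟨u, hu⟩ := hu
  have hc : (g.coeff 0 : Matrix ι ι (ZMod N)) = (u : ZMod N) • 1 := by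
    rw [hu]
    ext i j
    simp [Matrix.intCast_apply, Matrix.one_apply]
  have hcomm' : Commute (φ B) (φ D) := hcomm.map φ
  rw [hφ]
  refine _root_.exists_forall_pow_add_eq_pow (t := (-(↑u⁻¹ : ZMod N)) • φ D) ?_
  rw [hc, ← hcomm'.eq, mul_add, ← mul_assoc, ← pow_succ, mul_smul_comm, mul_one] at hzero'
  rw [mul_smul_comm, neg_smul, ← smul_neg, ← eq_neg_of_add_eq_zero_right hzero', smul_smul,
    Units.inv_mul, one_smul]

/-! ### Linear recurrences and sets meeting all residue classes -/

/-- For large `m`, the equation holds modulo every power of a fixed prime, because modulo such a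
power both sides are periodic from a point on that does not depend on the power. -/
theorem Matrix.exists_forall_ge_dotProduct_eq {ι : Type*} [Fintype ι] [DecidableEq ι]
    (B : Matrix ι ι ℤ) (x y : ι → ℤ) (c d : ℤ) (hc : c ≠ 0) (S : Set ℕ)
    (hS : ∀ P, 0 < P → ∀ m N : ℕ, ∃ n ∈ S, N ≤ n ∧ n ≡ m [MOD P])
    (h : ∀ n ∈ S, x ⬝ᵥ (B ^ n *ᵥ y) = d * c ^ n) :
    ∃ s, ∀ m, s ≤ m → x ⬝ᵥ (B ^ m *ᵥ y) = d * c ^ m := by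
  obtain ⟨s, g₀, hg₀, hper⟩ := B.exists_forall_pow_add_eq_pow
  refine ⟨s, fun m hm => ?_⟩
  obtain ⟨q, hqlt, hq⟩ := Nat.exists_infinite_primes ((g₀ * c).natAbs + 1)
  have hcop : IsCoprime (g₀ * c) (q : ℤ) := by
    rw [Int.isCoprime_iff_gcd_eq_one, Int.gcd_comm]
    refine (Nat.Prime.coprime_iff_not_dvd hq).2 fun hdvd => ?_
    have := Nat.le_of_dvd (Int.natAbs_pos.2 (mul_ne_zero hg₀ hc)) hdvd
    omega
  suffices hmod : ∀ e : ℕ, ((q ^ e : ℕ) : ℤ) ∣ x ⬝ᵥ (B ^ m *ᵥ y) - d * c ^ m by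
    by_contra hne
    have hne' : x ⬝ᵥ (B ^ m *ᵥ y) - d * c ^ m ≠ 0 := sub_ne_zero.2 hne
    have h1 := Nat.le_of_dvd (Int.natAbs_pos.2 hne')
      (Int.natCast_dvd.1 (hmod (x ⬝ᵥ (B ^ m *ᵥ y) - d * c ^ m).natAbs))
    exact absurd h1 (not_le.2 (Nat.lt_pow_self hq.one_lt))
  intro e
  set N := q ^ e with hN
  have hN0 : N ≠ 0 := pow_ne_zero _ hq.ne_zero
  have hcopN : IsCoprime (g₀ * c) (N : ℤ) := by
    rw [hN]
    push_cast
    exact hcop.pow_right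
  have hunit : ∀ z : ℤ, IsCoprime z (N : ℤ) → IsUnit (z : ZMod N) := by
    intro z hz
    have := (hz.map (Int.castRingHom (ZMod N)))
    simpa [isCoprime_zero_right] using this
  obtain ⟨P, hP, hBper⟩ := hper N hN0 (hunit _ hcopN.of_mul_left_left)
  obtain ⟨u, hu⟩ := hunit _ hcopN.of_mul_left_right
  -- `P * φ(N)` is a common period of the powers of `B` and of those of `c`.
  have hφ : 0 < N.totient := Nat.totient_pos.2 (Nat.pos_of_ne_zero hN0)
  obtain ⟨n, hnS, hmn, hmod⟩ := hS (P * N.totient) (Nat.mul_pos hP hφ) m m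
  obtain ⟨l, hl⟩ := (Nat.modEq_iff_dvd' hmn).1 hmod.symm
  obtain rfl : n = m + P * N.totient * l := by omega
  have hBper' : ∀ j, (B.map (Int.cast : ℤ → ZMod N)) ^ (m + P * j) =
      (B.map (Int.cast : ℤ → ZMod N)) ^ m := by
    intro j
    induction j with
    | zero => rfl
    | succ j ih => rw [mul_add, mul_one, ← add_assoc, hBper _ (by omega), ih]
  have hcper : (c : ZMod N) ^ (m + P * N.totient * l) = (c : ZMod N) ^ m := by
    rw [← hu, pow_add, show P * N.totient * l = N.totient * (P * l) by ring, pow_mul,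
      ← Units.val_pow_eq_pow_val u N.totient, ZMod.pow_totient]
    simp
  have hcast : ∀ n, ((x ⬝ᵥ (B ^ n *ᵥ y) : ℤ) : ZMod N) = (fun i => (x i : ZMod N)) ⬝ᵥ
      ((B.map (Int.cast : ℤ → ZMod N)) ^ n *ᵥ fun i => (y i : ZMod N)) := by
    intro n
    have hpow : (B ^ n).map (Int.cast : ℤ → ZMod N) = (B.map (Int.cast : ℤ → ZMod N)) ^ n :=
      map_pow (Int.castRingHom (ZMod N)).mapMatrix B n
    rw [← hpow]
    simp [dotProduct, Matrix.mulVec]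
  have hfin := congrArg (Int.cast : ℤ → ZMod N) (h _ hnS)
  rw [hcast, mul_assoc P, hBper', ← hcast, ← mul_assoc P] at hfin
  push_cast at hfin
  rw [hcper] at hfin
  rw [← ZMod.intCast_zmod_eq_zero_iff_dvd, Int.cast_sub, hfin]
  push_cast
  exact sub_self _

/-- A common denominator for a finite family of rational numbers. -/
theorem exists_int_family_eq_mul {ι : Type*} [Finite ι] (f : ι → ℚ) :
    ∃ (c : ℤ) (g : ι → ℤ), c ≠ 0 ∧ ∀ i, (g i : ℚ) = c * f i := by
  obtain ⟨b, hb⟩ := IsLocalization.exist_integer_multiples_of_finite (nonZeroDivisors ℤ) f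
  choose g hg using hb
  exact ⟨b, g, nonZeroDivisors.ne_zero b.2, fun i => by simpa using hg i⟩

theorem Matrix.exists_forall_ge_dotProduct_eq_one {ι : Type*} [Fintype ι] [DecidableEq ι]
    (A : Matrix ι ι ℚ) (x y : ι → ℚ) (S : Set ℕ)
    (hS : ∀ P, 0 < P → ∀ m N : ℕ, ∃ n ∈ S, N ≤ n ∧ n ≡ m [MOD P])
    (h : ∀ n ∈ S, x ⬝ᵥ (A ^ n *ᵥ y) = 1) :
    ∃ s, ∀ m, s ≤ m → x ⬝ᵥ (A ^ m *ᵥ y) = 1 := by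
  obtain ⟨c, B, hc, hB⟩ := exists_int_family_eq_mul fun p : ι × ι => A p.1 p.2
  obtain ⟨d, x', hd, hx⟩ := exists_int_family_eq_mul x
  obtain ⟨e, y', he, hy⟩ := exists_int_family_eq_mul y
  set B' : Matrix ι ι ℤ := Matrix.of fun i j => B (i, j)
  have hmap : B'.map (Int.cast : ℤ → ℚ) = (c : ℚ) • A := by
    ext i j
    simpa [B'] using hB (i, j)
  have hcast : ∀ n, ((x' ⬝ᵥ (B' ^ n *ᵥ y') : ℤ) : ℚ) =
      (d * e * c ^ n) * (x ⬝ᵥ (A ^ n *ᵥ y)) := by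
    intro n
    have hpow : (B' ^ n).map (Int.cast : ℤ → ℚ) = (c : ℚ) ^ n • A ^ n := by
      rw [← smul_pow, ← hmap]
      exact map_pow (Int.castRingHom ℚ).mapMatrix B' n
    have hpow' : ∀ i j, (((B' ^ n) i j : ℤ) : ℚ) = (c : ℚ) ^ n * (A ^ n) i j := fun i j =>
      congrFun (congrFun hpow i) j
    simp only [dotProduct, Matrix.mulVec, Int.cast_sum, Int.cast_mul, hx, hy, hpow',
      Finset.mul_sum]
    exact Finset.sum_congr rfl fun i _ => Finset.sum_congr rfl fun j _ => by ring
  have hne : ∀ n, (d * e * c ^ n : ℚ) ≠ 0 := fun n => by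
    have : (d * e * c ^ n : ℤ) ≠ 0 := mul_ne_zero (mul_ne_zero hd he) (pow_ne_zero _ hc)
    exact_mod_cast this
  obtain ⟨s, hs⟩ := B'.exists_forall_ge_dotProduct_eq x' y' c (d * e) hc S hS fun n hn => by
    have := hcast n
    rw [h n hn, mul_one] at this
    exact_mod_cast this
  refine ⟨s, fun m hm => mul_left_cancel₀ (hne m) ?_⟩
  rw [← hcast, hs m hm]
  push_cast
  ring

/-! ### Deterministic automata on unary words -/

theorem tape_replicate {α : Type*} (a : α) (n : ℕ) :
    tape (List.replicate n a) =
      TapeSymbol.leftEnd :: (List.replicate n (TapeSymbol.letter a) ++ [TapeSymbol.rightEnd]) := by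
  simp [tape]

/-- A configuration `(q, x)` is coded by the vector on `Q × Fin k` which is `x` on the block of
`q` and zero elsewhere; reading `a` then acts on it by a fixed matrix, and the vector `y` reads off
the first entry after the right endmarker if the final state is accepting, and `0 ≠ 1` if not. -/
theorem RTDBVA.exists_matrix_replicate_mem_language {k : ℕ} [NeZero k] {α Q : Type*} [Fintype Q]
    [DecidableEq Q] (M : RTDBVA k α Q) (a : α) :
    ∃ (A : Matrix (Q × Fin k) (Q × Fin k) ℚ) (x y : Q × Fin k → ℚ),
      ∀ n, List.replicate n a ∈ M.language ↔ x ⬝ᵥ (A ^ n *ᵥ y) = 1 := by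
  classical
  let emb : Q × (Fin k → ℚ) → Q × Fin k → ℚ := fun c p => if p.1 = c.1 then c.2 p.2 else 0
  let A : Matrix (Q × Fin k) (Q × Fin k) ℚ := Matrix.of fun p p' =>
    if p'.1 = (M.δ p.1 (TapeSymbol.letter a)).1 then
      (M.δ p.1 (TapeSymbol.letter a)).2 p.2 p'.2 else 0
  let y : Q × Fin k → ℚ := fun p =>
    if (M.δ p.1 TapeSymbol.rightEnd).1 ∈ M.accept then
      (M.δ p.1 TapeSymbol.rightEnd).2 p.2 0 else 0
  have hemb : ∀ c (z : Q × Fin k → ℚ), emb c ⬝ᵥ z = ∑ i, c.2 i * z (c.1, i) := by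
    intro c z
    simp [emb, dotProduct, Fintype.sum_prod_type, ite_mul]
  have hA : ∀ c, emb c ᵥ* A = emb (M.step c (TapeSymbol.letter a)) := by
    intro c
    ext p
    change emb c ⬝ᵥ (fun p' => A p' p) = _
    rw [hemb]
    by_cases hp : p.1 = (M.δ c.1 (TapeSymbol.letter a)).1 <;>
      simp [emb, A, RTDBVA.step, hp, Matrix.vecMul, dotProduct]
  have hAn : ∀ n c, emb c ᵥ* A ^ n =
      emb ((List.replicate n (TapeSymbol.letter a)).foldl M.step c) := by
    intro n
    induction n with
    | zero => simp
    | succ n ih =>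
      intro c
      rw [pow_succ', ← Matrix.vecMul_vecMul, hA, ih, List.replicate_succ, List.foldl_cons]
  refine ⟨A, emb (M.step (M.start, M.v) TapeSymbol.leftEnd), y, fun n => ?_⟩
  rw [Matrix.dotProduct_mulVec, hAn, hemb]
  change (M.final _).1 ∈ M.accept ∧ (M.final _).2 0 = 1 ↔ _
  rw [RTDBVA.final, tape_replicate, List.foldl_cons, List.foldl_append]
  set c := (List.replicate n (TapeSymbol.letter a)).foldl M.step
    (M.step (M.start, M.v) TapeSymbol.leftEnd)
  by_cases hacc : (M.δ c.1 TapeSymbol.rightEnd).1 ∈ M.accept <;>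
    simp [RTDBVA.step, y, hacc, Matrix.vecMul, dotProduct]

theorem replicate_mem_powLanguage {α : Type*} {a : α} {n : ℕ} :
    List.replicate n a ∈ powLanguage a ↔ ∃ k, 0 < k ∧ n = k + 2 ^ k := by
  constructor
  · rintro ⟨k, hk, h⟩
    exact ⟨k, hk, by simpa using congrArg List.length h⟩
  · rintro ⟨k, hk, rfl⟩
    exact ⟨k, hk, rfl⟩

theorem powLanguage_notMem_classRTDBVA {α : Type*} (a : α) (k : ℕ) [NeZero k] :
    powLanguage a ∉ classRTDBVA k α := by
  rintro ⟨Q, hQ, M, hM⟩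
  classical
  have := Fintype.ofFinite Q
  obtain ⟨A, x, y, hAxy⟩ := M.exists_matrix_replicate_mem_language a
  simp only [hM, replicate_mem_powLanguage] at hAxy
  obtain ⟨s, hs⟩ := A.exists_forall_ge_dotProduct_eq_one x y {n | ∃ k, 0 < k ∧ n = k + 2 ^ k}
    (fun P hP m N => by
      obtain ⟨k, hk, hmod⟩ := exists_add_two_pow_modEq P hP m (N + 1)
      exact ⟨k + 2 ^ k, ⟨k, by omega, rfl⟩, le_add_right (by omega), hmod⟩)
    fun n hn => (hAxy n).1 hn
  have hle : s ≤ s + 1 + 2 ^ (s + 1) + 1 := by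
    rw [add_assoc, add_assoc]
    exact Nat.le_add_right _ _
  obtain ⟨j, -, hj⟩ := (hAxy _).2 (hs _ hle)
  exact succ_add_two_pow_ne (s + 1) j (by omega) hj

/-! ### Regular languages -/

/-- A finite automaton as a deterministic blind vector automaton of dimension one, whose vector
is always `1`. -/
def DFA.toRTDBVA {α σ : Type*} (D : DFA α σ) : RTDBVA 1 α σ where
  δ
    | q, TapeSymbol.letter b => (D.step q b, 1)
    | q, _ => (q, 1)
  start := D.start
  accept := D.accept
  v := 1

theorem DFA.language_toRTDBVA {α σ : Type*} (D : DFA α σ) : D.toRTDBVA.language = D.accepts := by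
  have hfold : ∀ (w : List α) (q : σ), (w.map TapeSymbol.letter).foldl D.toRTDBVA.step (q, 1) =
      (D.evalFrom q w, 1) := by
    intro w
    induction w with
    | nil => intro q; rfl
    | cons b w ih =>
      intro q
      rw [List.map_cons, List.foldl_cons, DFA.evalFrom_cons, ← ih]
      simp [RTDBVA.step, DFA.toRTDBVA]
  have hfinal : ∀ w, D.toRTDBVA.final w = (D.eval w, 1) := by
    intro w
    have hleft : D.toRTDBVA.step (D.toRTDBVA.start, D.toRTDBVA.v) TapeSymbol.leftEnd =
        (D.start, 1) := by
      simp [RTDBVA.step, DFA.toRTDBVA]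
    rw [RTDBVA.final, tape, List.foldl_cons, List.foldl_append, hleft, hfold]
    simp [RTDBVA.step, DFA.toRTDBVA, DFA.eval]
  ext w
  change (D.toRTDBVA.final w).1 ∈ D.accept ∧ (D.toRTDBVA.final w).2 0 = 1 ↔ D.eval w ∈ D.accept
  simp [hfinal]

theorem Language.IsRegular.mem_classRTDBVA_one {α : Type*} {L : Language α} (hL : L.IsRegular) :
    L ∈ classRTDBVA 1 α := by
  obtain ⟨σ, _, D, rfl⟩ := hL
  exact ⟨σ, inferInstance, D.toRTDBVA, D.language_toRTDBVA⟩

/-! ### The nondeterministic automaton -/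

/-- The states of the automaton recognizing `powLanguage`: no letter read so far, doubling phase,
and decrementing phase. -/
inductive PowState
  | init
  | double
  | decr

instance : Finite PowState :=
  Finite.of_surjective (fun i : Fin 3 => ![PowState.init, PowState.double, PowState.decr] i) <| by
    rintro (_ | _ | _)
    exacts [⟨0, rfl⟩, ⟨1, rfl⟩, ⟨2, rfl⟩]

open Classical in
/-- The automaton recognizing `powLanguage`. The second entry of its vector is always `1`; the
first one is doubled on the letters of the first phase and decremented on those of the second.
The right endmarker increments it, because acceptance tests for the value `1` instead of `0`. -/
noncomputable def powMachine {α : Type*} (a : α) : RTNBVA 2 α PowState where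
  δ
    | PowState.init, TapeSymbol.leftEnd => {(PowState.init, 1)}
    | PowState.init, TapeSymbol.letter b =>
      if b = a then {(PowState.double, !![2, 0; 0, 1])} else ∅
    | PowState.double, TapeSymbol.letter b =>
      if b = a then {(PowState.double, !![2, 0; 0, 1]), (PowState.decr, !![1, 0; -1, 1])} else ∅
    | PowState.decr, TapeSymbol.letter b =>
      if b = a then {(PowState.decr, !![1, 0; -1, 1])} else ∅
    | PowState.decr, TapeSymbol.rightEnd => {(PowState.decr, !![1, 0; 1, 1])}
    | _, _ => ∅
  start := PowState.init
  accept := {PowState.decr}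
  v := ![1, 1]

/-- `powMachine a` accepts the remaining word `w` from the configuration with state `q` and
vector `(x, 1)`. -/
def PowAccepts {α : Type*} (a : α) (q : PowState) (x : ℚ) (w : List α) : Prop :=
  ∃ d : PowState × (Fin 2 → ℚ), (powMachine a).Reaches (q, ![x, 1])
    (w.map TapeSymbol.letter ++ [TapeSymbol.rightEnd]) d ∧ d.1 ∈ (powMachine a).accept ∧ d.2 0 = 1

theorem powAccepts_decr_iff {α : Type*} (a : α) (w : List α) (x : ℚ) :
    PowAccepts a PowState.decr x w ↔ ∃ m : ℕ, w = List.replicate m a ∧ x = m := by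
  induction w generalizing x with
  | nil =>
    simp [PowAccepts, RTNBVA.Reaches, powMachine, Matrix.vecMul_cons, List.replicate_eq_nil_iff]
  | cons b w ih =>
    have hstep : PowAccepts a PowState.decr x (b :: w) ↔
        b = a ∧ PowAccepts a PowState.decr (x - 1) w := by
      by_cases hb : b = a <;>
        simp [PowAccepts, RTNBVA.Reaches, powMachine, hb, Matrix.vecMul_cons, sub_eq_add_neg]
    rw [hstep, ih]
    constructor
    · rintro ⟨rfl, m, rfl, h⟩
      exact ⟨m + 1, rfl, by push_cast; linarith⟩
    · rintro ⟨m, hw, rfl⟩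
      cases m with
      | zero => simp at hw
      | succ m =>
        rw [List.replicate_succ, List.cons.injEq] at hw
        exact ⟨hw.1, m, hw.2, by push_cast; ring⟩

theorem powAccepts_double_iff {α : Type*} (a : α) (w : List α) (x : ℚ) :
    PowAccepts a PowState.double x w ↔
      ∃ k m : ℕ, 0 < m ∧ w = List.replicate (k + m) a ∧ 2 ^ k * x = m := by
  induction w generalizing x with
  | nil =>
    simp only [PowAccepts, RTNBVA.Reaches, powMachine, List.map_nil, List.nil_append,
      Finset.notMem_empty, false_and, exists_false, false_iff]
    rintro ⟨k, m, hm, h, -⟩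
    have := congrArg List.length h
    rw [List.length_nil, List.length_replicate] at this
    omega
  | cons b w ih =>
    have hstep : PowAccepts a PowState.double x (b :: w) ↔ b = a ∧
        (PowAccepts a PowState.double (2 * x) w ∨ PowAccepts a PowState.decr (x - 1) w) := by
      by_cases hb : b = a <;>
        simp [PowAccepts, RTNBVA.Reaches, powMachine, hb, Matrix.vecMul_cons, sub_eq_add_neg,
          or_and_right, exists_or, mul_comm]
    rw [hstep, ih, powAccepts_decr_iff]
    constructor
    · rintro ⟨rfl, ⟨k, m, hm, rfl, h⟩ | ⟨m, rfl, h⟩⟩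
      · exact ⟨k + 1, m, hm, by rw [Nat.add_right_comm, List.replicate_succ],
          by rw [← h]; ring⟩
      · exact ⟨0, m + 1, by omega, by rw [zero_add, List.replicate_succ],
          by push_cast; linarith⟩
    · rintro ⟨k, m, hm, hw, h⟩
      cases k with
      | zero =>
        obtain ⟨m, rfl⟩ := Nat.exists_eq_succ_of_ne_zero hm.ne'
        rw [zero_add, List.replicate_succ, List.cons.injEq] at hw
        exact ⟨hw.1, Or.inr ⟨m, hw.2, by push_cast at h; linarith⟩⟩
      | succ k =>
        rw [Nat.add_right_comm, List.replicate_succ, List.cons.injEq] at hw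
        exact ⟨hw.1, Or.inl ⟨k, m, hm, hw.2, by rw [← h]; ring⟩⟩

theorem powAccepts_init_iff {α : Type*} (a : α) (w : List α) :
    PowAccepts a PowState.init 1 w ↔ w ∈ powLanguage a := by
  change _ ↔ ∃ k : ℕ, 0 < k ∧ w = List.replicate (k + 2 ^ k) a
  cases w with
  | nil =>
    simp only [PowAccepts, RTNBVA.Reaches, powMachine, List.map_nil, List.nil_append,
      Finset.notMem_empty, false_and, exists_false, false_iff]
    rintro ⟨k, hk, h⟩
    have := congrArg List.length h
    rw [List.length_nil, List.length_replicate] at this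
    exact hk.ne' (Nat.add_eq_zero_iff.1 this.symm).1
  | cons b w =>
    have hstep : PowAccepts a PowState.init 1 (b :: w) ↔
        b = a ∧ PowAccepts a PowState.double 2 w := by
      by_cases hb : b = a <;>
        simp [PowAccepts, RTNBVA.Reaches, powMachine, hb, Matrix.vecMul_cons]
    rw [hstep, powAccepts_double_iff]
    constructor
    · rintro ⟨rfl, k, m, hm, rfl, h⟩
      rw [← pow_succ] at h
      have h' : 2 ^ (k + 1) = m := by exact_mod_cast h
      exact ⟨k + 1, by omega, by rw [h', Nat.add_right_comm, List.replicate_succ]⟩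
    · rintro ⟨k, hk, hw⟩
      obtain ⟨k, rfl⟩ := Nat.exists_eq_succ_of_ne_zero hk.ne'
      rw [Nat.succ_eq_add_one, Nat.add_right_comm, List.replicate_succ, List.cons.injEq] at hw
      exact ⟨hw.1, k, 2 ^ (k + 1), by positivity, hw.2, by push_cast; ring⟩

theorem language_powMachine {α : Type*} (a : α) : (powMachine a).language = powLanguage a := by
  ext w
  rw [← powAccepts_init_iff]
  change (∃ d, (powMachine a).Reaches (PowState.init, ![1, 1]) (tape w) d ∧ _) ↔ _
  simp [PowAccepts, tape, RTNBVA.Reaches, powMachine]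

theorem powLanguage_mem_classRTNBVA {α : Type*} (a : α) : powLanguage a ∈ classRTNBVA 2 α :=
  ⟨PowState, inferInstance, powMachine a, language_powMachine a⟩

/-! ### The separation -/

theorem mainTheorem4 {α : Type*} [Finite α] (a : α) :
    powLanguage a ∈ classRTNBVA 2 α ∧
    ¬ (powLanguage a).IsRegular ∧
    (∀ (k : ℕ) [NeZero k], powLanguage a ∉ classRTDBVA k α) ∧
    ¬ (classRTNBVA 2 α ⊆ ⋃ (k : ℕ) (_ : NeZero k), classRTDBVA k α) := by
  refine ⟨powLanguage_mem_classRTNBVA a,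
    fun h => powLanguage_notMem_classRTDBVA a 1 h.mem_classRTDBVA_one,
    fun k _ => powLanguage_notMem_classRTDBVA a k, fun h => ?_⟩
  obtain ⟨k, hk, hmem⟩ := Set.mem_iUnion₂.1 (h (powLanguage_mem_classRTNBVA a))
  exact powLanguage_notMem_classRTDBVA a k hmem
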